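/- Signals are arbitrary sequences $x=(x(0),x(1),\dots)$ with $x(k)\in\mathbb R^n$; write $P_Tx=(x(0),\dots,x(T),0,\dots)$ and $\|x\|_\infty=\sup_k|x(k)|_\infty\in[0,\infty]$. A linear system $\mathbf H$ is a linear map on signals; it is causal if $P_T\mathbf H=P_T\mathbf HP_T$ for all $T\ge 0$, time-invariant if it commutes with the one-step delay, and stable if its induced norm $$\|\mathbf H\|_1=\sup_T\ \sup_{x\ne0}\frac{\|P_T\mathbf Hx\|_\infty}{\|P_Tx\|_\infty}$$ is finite (with $0/0=0$ and $a/0=\infty$ for $a>0$). The scalar system $H_{ij}$ is the response of output $i$ to a signal entering at input $j$, and the magnitude matrix of a stable $\mathbf H$ is $M_H=(\|H_{ij}\|_1)_{i,j}\in\mathbb R^{n\times n}$. Let $\mathscr D$ be the set of stable causal linear (possibly time-varying) systems $\boldsymbol\Delta$ with $n$ inputs and outputs whose off-diagonal elements are zero; write $\boldsymbol\delta_i$ for the diagonal elements of $\boldsymbol\Delta$. Let $\mathcal D\subset\mathbb R^{n\times n}$ be the set of diagonal matrices with positive diagonal entries. For a system $\mathbf G$ with $n$ inputs and outputs put $$\nu_{\mathscr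 D}(\mathbf G)=\frac{1}{\inf\{\sum_{i=1}^n\|\boldsymbol\delta_i\|_1 : \boldsymbol\Delta\in\mathscr D,\ (I-\mathbf G\boldsymbol\Delta)^{-1}\text{ unstable}\}},\qquad \overline\nu_{\mathscr D}(\mathbf G)=\inf_{D\in\mathcal D}|DM_GD^{-1}|_{1,\infty},$$ where "$(I-\mathbf G\boldsymbol\Delta)^{-1}$ unstable" means that $I-\mathbf G\boldsymbol\Delta$ has no stable inverse on the space of all signals, $|A|_{1,\infty}=\sup_{x\ne0}|Ax|_\infty/|x|_1$, and values are taken in $[0,\infty]$ (so $1/\inf\emptyset=1/\infty=0$). A matrix $A\in\mathbb R^{n\times n}$ is diagonally maximal if its maximum absolute element appears on the diagonal, i.e. there is a $k$ with $|A_{ij}|\le|A_{kk}|$ for all $i,j$. **Corollary.** Let $\mathbf G$ be a stable, causal, linear time-invariant system with $n$ inputs and outputs. If $DM_GD^{-1}$ is diagonally maximal for some $D\in\mathcal D$, then $\overline\nu_{\mathscr D}(\mathbf G)=\nu_{\mathscr D}(\mathbf G)$. -/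

import Mathlib

open scoped ENNReal

noncomputable section

namespace RobustNu

/-! ### Signals and operators

The extended space of `ℓ_∞` signals with values in `E` is the space `ℕ → E` of all sequences: every
truncation of a sequence is bounded. `Fin n → ℝ` carries the maximum norm. -/

/-- The `ℓ_∞` norm `sup_k |x(k)|` of a signal, with values in `[0, ∞]`. -/
def supNorm {E : Type} [NormedAddCommGroup E] (x : ℕ → E) : ℝ≥0∞ :=
  ⨆ k, ‖x k‖ₑ

/-- The truncation `P_T x = (x(0), …, x(T), 0, …)`. -/
def trunc {E : Type} [NormedAddCommGroup E] (T : ℕ) (x : ℕ → E) : ℕ → E :=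
  fun k => if k ≤ T then x k else 0

/-- The delay `(x(0), x(1), …) ↦ (0, x(0), x(1), …)`. -/
def delay {E : Type} [NormedAddCommGroup E] (x : ℕ → E) : ℕ → E
  | 0 => 0
  | k + 1 => x k

/-- Linear systems from signals in `E` to signals in `F`, possibly time-varying. -/
abbrev Sys (E F : Type) [NormedAddCommGroup E] [NormedSpace ℝ E]
    [NormedAddCommGroup F] [NormedSpace ℝ F] : Type :=
  (ℕ → E) →ₗ[ℝ] (ℕ → F)

section

variable {E F : Type} [NormedAddCommGroup E] [NormedSpace ℝ E]
  [NormedAddCommGroup F] [NormedSpace ℝ F]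

/-- Causality: `P_T H = P_T H P_T` for all `T`. -/
def IsCausal (H : Sys E F) : Prop :=
  ∀ (T : ℕ) (x : ℕ → E), trunc T (H x) = trunc T (H (trunc T x))

/-- Time invariance: `H` commutes with the delay. -/
def IsTimeInvariant (H : Sys E F) : Prop :=
  ∀ x : ℕ → E, H (delay x) = delay (H x)

/-- The induced norm `sup_T sup_{x ≠ 0} ‖P_T H x‖_∞ / ‖P_T x‖_∞`, with values in `[0, ∞]`.
Here `0 / 0 = 0` (so that `x = 0` contributes nothing) and `a / 0 = ∞` for `a ≠ 0`. -/
def gain (H : Sys E F) : ℝ≥0∞ :=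
  ⨆ (T : ℕ) (x : ℕ → E), supNorm (trunc T (H x)) / supNorm (trunc T x)

/-- `ℓ_∞` stability: the induced norm is finite. -/
def IsStable (H : Sys E F) : Prop :=
  gain H < ∞

/-- The system `H` is invertible on the extended signal space and its inverse is stable. -/
def HasStableInverse (H : Sys E E) : Prop :=
  ∃ K : Sys E E, K ∘ₗ H = LinearMap.id ∧ H ∘ₗ K = LinearMap.id ∧ IsStable K

end

/-- The scalar element `H_ij` of a system with `n` inputs and outputs: the response of output `i`
to a signal that enters at input `j`. -/
def entry {n : ℕ} (H : Sys (Fin n → ℝ) (Fin n → ℝ)) (i j : Fin n) : Sys ℝ ℝ where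
  toFun x := fun t => H (fun s => Pi.single j (x s)) t i
  map_add' x y := by
    have h : (fun s => Pi.single j ((x + y) s) : ℕ → Fin n → ℝ)
        = (fun s => Pi.single j (x s)) + (fun s => Pi.single j (y s)) := by
      funext s
      simp [Pi.single_add]
    rw [h, map_add]
    rfl
  map_smul' c x := by
    have h : (fun s => Pi.single j ((c • x) s) : ℕ → Fin n → ℝ)
        = c • (fun s => Pi.single j (x s)) := by
      funext s
      simp [← Pi.single_smul]
    rw [h, map_smul]
    rfl

/-- The magnitude matrix `(‖H_ij‖_1)_ij`; its entries are meaningful for a stable system, whose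
elements all have finite norm. -/
def magnitudeMatrix {n : ℕ} (H : Sys (Fin n → ℝ) (Fin n → ℝ)) : Matrix (Fin n) (Fin n) ℝ :=
  Matrix.of fun i j => (gain (entry H i j)).toReal

/-- The stable causal linear time-varying systems whose off-diagonal elements are zero. -/
def diagonalUncertainty (n : ℕ) : Set (Sys (Fin n → ℝ) (Fin n → ℝ)) :=
  {Δ | IsCausal Δ ∧ IsStable Δ ∧ ∀ i j, i ≠ j → entry Δ i j = 0}

/-- The robustness measure `ν(G) = 1 / inf {∑ i, ‖δ_i‖_1}`, over the diagonal uncertainties `Δ` for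
which `I - GΔ` has no stable inverse; `1 / inf ∅ = 1 / ∞ = 0`. -/
def nu {n : ℕ} (G : Sys (Fin n → ℝ) (Fin n → ℝ)) : ℝ≥0∞ :=
  1 / sInf {r : ℝ≥0∞ | ∃ Δ ∈ diagonalUncertainty n,
    ¬ HasStableInverse (LinearMap.id - G ∘ₗ Δ) ∧ r = ∑ i, gain (entry Δ i i)}

/-! ### Matrices -/

/-- The diagonal matrices with positive diagonal entries. -/
def positiveDiagonal (n : ℕ) : Set (Matrix (Fin n) (Fin n) ℝ) :=
  {D | ∃ d : Fin n → ℝ, (∀ i, 0 < d i) ∧ D = Matrix.diagonal d}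

/-- The norm of a matrix induced by the `1`-norm on the domain and the `∞`-norm on the codomain,
`sup_{x ≠ 0} |A x|_∞ / |x|_1` (again `x = 0` contributes `0 / 0 = 0`). -/
def oneInfNorm {n : ℕ} (A : Matrix (Fin n) (Fin n) ℝ) : ℝ≥0∞ :=
  ⨆ x : Fin n → ℝ, ‖A.mulVec x‖ₑ / ∑ i, ‖x i‖ₑ

/-- The upper bound `inf_D |D M_G D⁻¹|_{1, ∞}` over the positive diagonal matrices `D`. -/
def nuBar {n : ℕ} (G : Sys (Fin n → ℝ) (Fin n → ℝ)) : ℝ≥0∞ :=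
  ⨅ D ∈ positiveDiagonal n, oneInfNorm (D * magnitudeMatrix G * D⁻¹)

/-- The maximum absolute element of `A` appears on the diagonal. -/
def IsDiagonallyMaximal {n : ℕ} (A : Matrix (Fin n) (Fin n) ℝ) : Prop :=
  ∃ k, ∀ i j, |A i j| ≤ |A k k|

end RobustNu

end

open scoped ENNReal
noncomputable section
namespace RobustNu

/-! ### Truncated norms and real-valued gain bounds. -/

section Gain

/-! Both sides equal `m = ‖G_kk‖_1`, where `k` is the index at which the scaled magnitude matrix has
its diagonal maximum. The `1`-to-`∞` norm of a matrix is its largest absolute entry, and diagonal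
scaling fixes diagonal entries: every scaling gives at least `m`, and the given one attains `m`.

For `ν ≤ m`, the given scaling `d` bounds `G Δ` by `m ∑ ‖δ_i‖_1` in the norm `max_i d_i |x_i|`
(`weightedBound_comp`), and a weighted small gain theorem applies when this is below `1`. For `ν ≥
m`, any gain `c > 1/m` placed in channel `k` alone destabilizes (`exists_destabilizing`): a
time-varying sample-and-sign perturbation aligns its output with the impulse response of `G_kk`, so
that the loop signal grows geometrically at the sampling instants. -/

lemma supNorm_trunc_le_iff {E : Type} [NormedAddCommGroup E] (T : ℕ) (x : ℕ → E) (b : ℝ≥0∞) :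
    supNorm (trunc T x) ≤ b ↔ ∀ s ≤ T, ‖x s‖ₑ ≤ b := by
  unfold supNorm trunc
  rw [iSup_le_iff]
  refine ⟨fun h s hs => by simpa [hs] using h s, fun h s => ?_⟩
  by_cases hs : s ≤ T
  · simpa [hs] using h s hs
  · simp [hs]

lemma supNorm_trunc_ne_top {E : Type} [NormedAddCommGroup E] (T : ℕ) (x : ℕ → E) : supNorm (trunc T x) ≠ ∞ := by
  have h : supNorm (trunc T x) ≤ ∑ s ∈ Finset.range (T + 1), ‖x s‖ₑ := by
    rw [supNorm_trunc_le_iff]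
    intro s hs
    exact Finset.single_le_sum (f := fun s => ‖x s‖ₑ) (fun _ _ => zero_le)
      (Finset.mem_range.2 (by omega))
  refine ne_top_of_le_ne_top ?_ h
  exact ENNReal.sum_ne_top.2 fun _ _ => enorm_ne_top

variable {E F : Type} [NormedAddCommGroup E] [NormedSpace ℝ E]
  [NormedAddCommGroup F] [NormedSpace ℝ F]

/-- Turns the `[0, ∞]` supremum of quotients into real inequalities; the case `r = 0` carries the
convention `a / 0 = ∞`. -/
lemma gain_le_ofReal_iff (H : Sys E F) {C : ℝ} (hC : 0 ≤ C) :
    gain H ≤ ENNReal.ofReal C ↔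
      ∀ (T : ℕ) (x : ℕ → E) (r : ℝ), (∀ s ≤ T, ‖x s‖ ≤ r) → ∀ t ≤ T, ‖H x t‖ ≤ C * r := by
  unfold gain
  simp only [iSup_le_iff]
  refine forall₂_congr fun T x => ?_
  rw [ENNReal.div_le_iff_le_mul (Or.inr ENNReal.ofReal_ne_top)
    (Or.inl (supNorm_trunc_ne_top T x)), supNorm_trunc_le_iff]
  constructor
  · intro h r hr t ht
    have hr0 : 0 ≤ r := (norm_nonneg _).trans (hr 0 (Nat.zero_le _))
    have h1 : supNorm (trunc T x) ≤ ENNReal.ofReal r := by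
      rw [supNorm_trunc_le_iff]
      intro s hs
      rw [← ofReal_norm]
      exact ENNReal.ofReal_le_ofReal (hr s hs)
    have h2 := (h t ht).trans (mul_le_mul_right h1 (ENNReal.ofReal C))
    rw [← ofReal_norm, ← ENNReal.ofReal_mul hC] at h2
    exact (ENNReal.ofReal_le_ofReal_iff (mul_nonneg hC hr0)).1 h2
  · intro h t ht
    have h1 := h (supNorm (trunc T x)).toReal (fun s hs => by
      rw [← toReal_enorm]
      exact ENNReal.toReal_mono (supNorm_trunc_ne_top T x)
        ((supNorm_trunc_le_iff T x _).1 le_rfl s hs)) t ht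
    rw [← ofReal_norm]
    refine (ENNReal.ofReal_le_ofReal h1).trans ?_
    rw [ENNReal.ofReal_mul hC, ENNReal.ofReal_toReal (supNorm_trunc_ne_top T x)]

lemma norm_apply_le_of_gain (H : Sys E F) (hH : IsStable H) {T : ℕ} {x : ℕ → E} {r : ℝ}
    (hr : ∀ s ≤ T, ‖x s‖ ≤ r) {t : ℕ} (ht : t ≤ T) : ‖H x t‖ ≤ (gain H).toReal * r :=
  (gain_le_ofReal_iff H ENNReal.toReal_nonneg).1
    (ENNReal.ofReal_toReal (ne_of_lt hH)).ge T x r hr t ht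

lemma IsCausal.congr {H : Sys E F} (hH : IsCausal H) {T : ℕ} {x y : ℕ → E}
    (h : ∀ s ≤ T, x s = y s) {t : ℕ} (ht : t ≤ T) : H x t = H y t := by
  have hxy : trunc T x = trunc T y := by
    funext s
    by_cases hs : s ≤ T
    · simp [trunc, hs, h s hs]
    · simp [trunc, hs]
  have h1 := congrFun (hH T x) t
  have h2 := congrFun (hH T y) t
  rw [hxy, ← h2] at h1
  simpa [trunc, ht] using h1

lemma isCausal_of_congr {H : Sys E F}
    (h : ∀ (T : ℕ) (x y : ℕ → E), (∀ s ≤ T, x s = y s) → H x T = H y T) : IsCausal H := by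
  intro T x
  funext t
  by_cases ht : t ≤ T
  · simp only [trunc, ht, if_true]
    exact h t x (trunc T x) fun s hs => by simp [trunc, hs.trans ht]
  · simp [trunc, ht]

end Gain

/-! ### Scalar elements of a multivariable system. -/

section Entries

variable {n : ℕ}

lemma apply_eq_sum_entry (H : Sys (Fin n → ℝ) (Fin n → ℝ)) (x : ℕ → Fin n → ℝ) (t : ℕ)
    (i : Fin n) : H x t i = ∑ j, entry H i j (fun s => x s j) t := by
  have hx : x = ∑ j, (fun s => Pi.single j (x s j) : ℕ → Fin n → ℝ) := by
    funext s
    rw [Finset.sum_apply]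
    exact (Finset.univ_sum_single (x s)).symm
  conv_lhs => rw [hx, map_sum]
  simp [Finset.sum_apply, entry]

lemma gain_entry_le (H : Sys (Fin n → ℝ) (Fin n → ℝ)) (hH : IsStable H) (i j : Fin n) :
    gain (entry H i j) ≤ gain H := by
  rw [← ENNReal.ofReal_toReal (ne_of_lt hH), gain_le_ofReal_iff _ ENNReal.toReal_nonneg]
  intro T x r hr t ht
  have hx : ∀ s ≤ T, ‖(Pi.single j (x s) : Fin n → ℝ)‖ ≤ r := fun s hs => by
    rw [Pi.norm_single]
    exact hr s hs
  have h := norm_apply_le_of_gain H hH hx ht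
  exact (norm_le_pi_norm _ i).trans h

lemma isStable_entry (H : Sys (Fin n → ℝ) (Fin n → ℝ)) (hH : IsStable H) (i j : Fin n) :
    IsStable (entry H i j) :=
  (gain_entry_le H hH i j).trans_lt hH

lemma isCausal_entry (H : Sys (Fin n → ℝ) (Fin n → ℝ)) (hH : IsCausal H) (i j : Fin n) :
    IsCausal (entry H i j) := by
  refine isCausal_of_congr fun T x y h => ?_
  exact congrFun (hH.congr (T := T) (fun s hs => by rw [h s hs]) le_rfl) i

lemma isTimeInvariant_entry (H : Sys (Fin n → ℝ) (Fin n → ℝ)) (hH : IsTimeInvariant H)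
    (i j : Fin n) : IsTimeInvariant (entry H i j) := by
  intro x
  have hx : (fun s => Pi.single j (delay x s) : ℕ → Fin n → ℝ)
      = delay (fun s => Pi.single j (x s)) := by
    funext s
    cases s <;> simp [delay]
  funext t
  change H (fun s => Pi.single j (delay x s)) t i = _
  rw [hx, hH]
  cases t <;> simp [delay, entry]

end Entries

/-! ### Small gain theorem in a weighted maximum norm. -/

section SmallGain

variable {n : ℕ} {H : Sys (Fin n → ℝ) (Fin n → ℝ)} {d : Fin n → ℝ} {c : ℝ}

/-- `H` is bounded by `c` in the weighted norm `max_i d_i |x_i|`, on every initial interval. -/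
def WeightedBound (H : Sys (Fin n → ℝ) (Fin n → ℝ)) (d : Fin n → ℝ) (c : ℝ) : Prop :=
  ∀ (T : ℕ) (x : ℕ → Fin n → ℝ) (r : ℝ), 0 ≤ r → (∀ s ≤ T, ∀ j, d j * |x s j| ≤ r) →
    ∀ t ≤ T, ∀ i, d i * |H x t i| ≤ c * r

/-- A finite window has a time and channel where `d j * |x s j|` is largest. If `M` is that value,
the triangle inequality there gives `M ≤ ρ + c M`. -/
lemma WeightedBound.resolvent_bound (hH : WeightedBound H d c) (hd : ∀ i, 0 < d i) (hc : c < 1)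
    {T : ℕ} {x : ℕ → Fin n → ℝ} {ρ : ℝ}
    (hy : ∀ s ≤ T, ∀ j, d j * |x s j - H x s j| ≤ ρ) :
    ∀ s ≤ T, ∀ j, d j * |x s j| ≤ ρ / (1 - c) := by
  intro s hs j
  obtain ⟨⟨s₀, j₀⟩, hmem, hmax⟩ := Finset.exists_max_image
    (Finset.range (T + 1) ×ˢ (Finset.univ : Finset (Fin n))) (fun p => d p.2 * |x p.1 p.2|)
    ⟨(s, j), by simp; omega⟩
  have hs₀ : s₀ ≤ T := by
    have := (Finset.mem_product.1 hmem).1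
    simp at this
    omega
  have hmax' : ∀ s ≤ T, ∀ j, d j * |x s j| ≤ d j₀ * |x s₀ j₀| := fun s hs j =>
    hmax (s, j) (by simp; omega)
  have hb := hH T x _ (mul_nonneg (hd j₀).le (abs_nonneg _)) hmax' s₀ hs₀ j₀
  have hρ := hy s₀ hs₀ j₀
  have htri : |x s₀ j₀| ≤ |x s₀ j₀ - H x s₀ j₀| + |H x s₀ j₀| := by
    simpa using abs_add_le (x s₀ j₀ - H x s₀ j₀) (H x s₀ j₀)
  have htri' := mul_le_mul_of_nonneg_left htri (hd j₀).le
  rw [le_div_iff₀ (by linarith)]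
  have := mul_le_mul_of_nonneg_right (hmax' s hs j) (by linarith : (0 : ℝ) ≤ 1 - c)
  nlinarith

lemma WeightedBound.eq_zero (hH : WeightedBound H d c) (hd : ∀ i, 0 < d i) (hc : c < 1)
    {T : ℕ} {x : ℕ → Fin n → ℝ} (hx : ∀ s ≤ T, x s = H x s) : ∀ s ≤ T, x s = 0 := by
  intro s hs
  funext j
  have h := hH.resolvent_bound hd hc (T := T) (x := x) (ρ := 0)
    (fun s hs j => by rw [← hx s hs]; simp) s hs j
  rw [zero_div] at h
  have h1 : |x s j| ≤ 0 := by
    by_contra hlt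
    push Not at hlt
    exact absurd h (not_le.2 (mul_pos (hd j) hlt))
  simpa using h1

/-- Extension by zero of a signal on `{0, …, T}`. -/
def extendZero (n T : ℕ) : (Fin (T + 1) → Fin n → ℝ) →ₗ[ℝ] (ℕ → Fin n → ℝ) where
  toFun u := fun s => if h : s < T + 1 then u ⟨s, h⟩ else 0
  map_add' u v := by
    funext s
    by_cases h : s < T + 1 <;> simp only [Pi.add_apply, h, dite_true, dite_false, add_zero]
  map_smul' a u := by
    funext s
    by_cases h : s < T + 1 <;> simp only [Pi.smul_apply, RingHom.id_apply, h, dite_true, dite_false, smul_zero]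

/-- On a window, `I - H` compresses to an endomorphism of a finite-dimensional space, where
injectivity implies surjectivity; no Neumann series is needed. -/
lemma WeightedBound.exists_finite_horizon (hH : WeightedBound H d c) (hd : ∀ i, 0 < d i)
    (hc : c < 1) (y : ℕ → Fin n → ℝ) (T : ℕ) :
    ∃ x : ℕ → Fin n → ℝ, ∀ s ≤ T, x s - H x s = y s := by
  let L : (Fin (T + 1) → Fin n → ℝ) →ₗ[ℝ] (Fin (T + 1) → Fin n → ℝ) :=
    LinearMap.funLeft ℝ (Fin n → ℝ) (fun s : Fin (T + 1) => (s : ℕ)) ∘ₗ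
      (LinearMap.id - H : Sys (Fin n → ℝ) (Fin n → ℝ)) ∘ₗ extendZero n T
  have hL : ∀ u s, L u s = extendZero n T u s - H (extendZero n T u) s := fun u s => rfl
  have hinj : Function.Injective L := by
    rw [injective_iff_map_eq_zero]
    intro u hu
    have h0 := hH.eq_zero hd hc (T := T) (x := extendZero n T u) (fun s hs => by
      have := congrFun hu ⟨s, by omega⟩
      rw [hL] at this
      exact sub_eq_zero.1 this)
    funext s
    have := h0 s (by omega)
    exact (dif_pos s.2).symm.trans this
  obtain ⟨u, hu⟩ := LinearMap.injective_iff_surjective.1 hinj (fun s => y s)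
  refine ⟨extendZero n T u, fun s hs => ?_⟩
  have := congrFun hu ⟨s, by omega⟩
  rwa [hL] at this

/-- Uniqueness makes the window solutions agree on overlaps, so they glue along the diagonal `X t
t`; causality shows that the glued signal solves the equation. -/
lemma WeightedBound.bijective (hH : WeightedBound H d c) (hcausal : IsCausal H)
    (hd : ∀ i, 0 < d i) (hc : c < 1) : Function.Bijective (LinearMap.id - H : Sys (Fin n → ℝ) (Fin n → ℝ)) := by
  constructor
  · rw [injective_iff_map_eq_zero]
    intro x hx
    funext t
    exact hH.eq_zero hd hc (T := t) (fun s _ => sub_eq_zero.1 (congrFun hx s)) t le_rfl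
  · intro y
    choose X hX using hH.exists_finite_horizon hd hc y
    have hagree : ∀ T t, t ≤ T → X t t = X T t := by
      intro T t ht
      have h0 := hH.eq_zero hd hc (T := t) (x := X t - X T) (fun s hs => by
        have h1 := hX t s hs
        have h2 := hX T s (hs.trans ht)
        rw [map_sub, Pi.sub_apply, Pi.sub_apply, ← sub_eq_zero]
        rw [← h2] at h1
        rw [← sub_eq_zero.2 h1]
        abel) t le_rfl
      exact sub_eq_zero.1 h0
    refine ⟨fun t => X t t, ?_⟩
    funext t
    have h1 := hcausal.congr (T := t) (x := fun t => X t t) (y := X t)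
      (fun s hs => hagree t s hs) le_rfl
    change X t t - H (fun t => X t t) t = y t
    rw [h1, hX t t le_rfl]

/-- The small gain theorem in a weighted maximum norm. -/
theorem WeightedBound.hasStableInverse (hH : WeightedBound H d c) (hcausal : IsCausal H)
    (hd : ∀ i, 0 < d i) (hc : c < 1) : HasStableInverse (LinearMap.id - H) := by
  let e := LinearEquiv.ofBijective _ (hH.bijective hcausal hd hc)
  have he : ∀ x, e x = x - H x := fun x => rfl
  refine ⟨e.symm.toLinearMap, ?_, ?_, ?_⟩
  · ext1 x
    exact e.symm_apply_apply x
  · ext1 x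
    exact e.apply_symm_apply x
  · have hc' : 0 < 1 - c := by linarith
    have hS : 0 ≤ ∑ i, d i := Finset.sum_nonneg fun i _ => (hd i).le
    have hS' : 0 ≤ ∑ i, (d i)⁻¹ := Finset.sum_nonneg fun i _ => (inv_pos.2 (hd i)).le
    -- The sums of `d i` and `(d i)⁻¹` dominate the maxima needed to pass to the weighted norm and
    -- back.
    have hC : 0 ≤ (∑ i, (d i)⁻¹) * ((∑ i, d i) / (1 - c)) := by positivity
    refine lt_of_le_of_lt ((gain_le_ofReal_iff _ hC).2 ?_) ENNReal.ofReal_lt_top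
    intro T y r hr t ht
    have hr0 : 0 ≤ r := (norm_nonneg _).trans (hr 0 (Nat.zero_le _))
    obtain ⟨x, rfl⟩ := e.surjective y
    simp only [LinearEquiv.coe_coe, LinearEquiv.symm_apply_apply]
    have hb := hH.resolvent_bound hd hc (T := T) (x := x) (ρ := (∑ i, d i) * r)
      (fun s hs j => by
        have h1 : |x s j - H x s j| ≤ r := (norm_le_pi_norm (e x s) j).trans (hr s hs)
        exact mul_le_mul (Finset.single_le_sum (fun i _ => (hd i).le) (Finset.mem_univ j)) h1
          (abs_nonneg _) hS) t ht
    refine (pi_norm_le_iff_of_nonneg (mul_nonneg hC hr0)).2 fun i => ?_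
    have h1 : |x t i| = (d i)⁻¹ * (d i * |x t i|) := by
      rw [inv_mul_cancel_left₀ (hd i).ne']
    rw [Real.norm_eq_abs, h1]
    have h2 : (d i)⁻¹ ≤ ∑ i, (d i)⁻¹ :=
      Finset.single_le_sum (f := fun i => (d i)⁻¹) (fun i _ => (inv_pos.2 (hd i)).le)
        (Finset.mem_univ i)
    calc _ ≤ (∑ i, (d i)⁻¹) * ((∑ i, d i) * r / (1 - c)) :=
          mul_le_mul h2 (hb i) (mul_nonneg (hd i).le (abs_nonneg _)) hS'
      _ = _ := by ring

/-- If the weighted magnitudes of `G` are at most `m`, then `G Δ` is bounded by `m ∑ ‖δ_i‖_1`. -/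
lemma weightedBound_comp {G Δ : Sys (Fin n → ℝ) (Fin n → ℝ)} (hG : IsStable G)
    (hΔ : Δ ∈ diagonalUncertainty n) (hd : ∀ i, 0 < d i) {m : ℝ}
    (hm : ∀ i j, d i * (gain (entry G i j)).toReal / d j ≤ m) :
    WeightedBound (G ∘ₗ Δ) d (m * ∑ i, (gain (entry Δ i i)).toReal) := by
  obtain ⟨-, hΔs, hoff⟩ := hΔ
  intro T x r hr hx t ht i
  have h1 : ∀ s ≤ T, ∀ j, |Δ x s j| ≤ (gain (entry Δ j j)).toReal * (r / d j) := by
    intro s hs j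
    rw [apply_eq_sum_entry, Finset.sum_eq_single j]
    · refine norm_apply_le_of_gain _ (isStable_entry Δ hΔs j j) (fun s hs => ?_) hs
      rw [le_div_iff₀ (hd j), mul_comm]
      exact hx s hs j
    · intro l _ hl
      rw [hoff j l hl.symm]
      rfl
    · simp
  have h2 : |G (Δ x) t i| ≤ ∑ j, (gain (entry G i j)).toReal *
      ((gain (entry Δ j j)).toReal * (r / d j)) := by
    rw [apply_eq_sum_entry]
    refine (Finset.abs_sum_le_sum_abs _ _).trans (Finset.sum_le_sum fun j _ => ?_)
    exact norm_apply_le_of_gain _ (isStable_entry G hG i j) (T := T) (fun s hs => h1 s hs j) ht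
  refine (mul_le_mul_of_nonneg_left h2 (hd i).le).trans ?_
  rw [Finset.mul_sum, Finset.mul_sum, Finset.sum_mul]
  refine Finset.sum_le_sum fun j _ => ?_
  calc _ = d i * (gain (entry G i j)).toReal / d j * ((gain (entry Δ j j)).toReal * r) := by ring
    _ ≤ m * ((gain (entry Δ j j)).toReal * r) :=
        mul_le_mul_of_nonneg_right (hm i j) (mul_nonneg ENNReal.toReal_nonneg hr)
    _ = _ := by ring

lemma isCausal_comp {G Δ : Sys (Fin n → ℝ) (Fin n → ℝ)} (hG : IsCausal G) (hΔ : IsCausal Δ) :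
    IsCausal (G ∘ₗ Δ) :=
  isCausal_of_congr fun T _ _ h =>
    hG.congr (T := T) (fun _ hs => hΔ.congr (T := T) h hs) le_rfl

end SmallGain

/-! ### Time-invariant scalar systems: the gain is the `ℓ_1` norm of the impulse response. -/

section Convolution

/-- The unit impulse at time `0`. -/
def impulse : ℕ → ℝ := fun t => if t = 0 then 1 else 0

lemma iterate_delay_apply (s : ℕ) (f : ℕ → ℝ) (t : ℕ) :
    (delay^[s] f) t = if s ≤ t then f (t - s) else 0 := by
  induction s generalizing t with
  | zero => simp
  | succ s ih =>
    rw [Function.iterate_succ_apply']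
    cases t with
    | zero => simp [delay]
    | succ t => simp [delay, ih]

/-- No continuity is needed: by causality, the input up to time `t` may be replaced by a finite
combination of delayed impulses. -/
lemma apply_eq_convolution {g : Sys ℝ ℝ} (hc : IsCausal g) (ht : IsTimeInvariant g)
    (x : ℕ → ℝ) (t : ℕ) :
    g x t = ∑ k ∈ Finset.range (t + 1), g impulse k * x (t - k) := by
  have h1 : g x t = g (∑ s ∈ Finset.range (t + 1), x s • delay^[s] impulse) t := by
    refine hc.congr (T := t) (fun s hs => ?_) le_rfl
    rw [Finset.sum_apply, Finset.sum_eq_single s]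
    · simp [iterate_delay_apply, impulse]
    · intro b _ hb
      simp only [Pi.smul_apply, iterate_delay_apply, impulse, smul_eq_mul]
      split_ifs <;> first | omega | simp
    · intro h
      exact absurd (Finset.mem_range.2 (by omega)) h
  have h2 : ∀ s, g (delay^[s] impulse) = delay^[s] (g impulse) := by
    intro s
    induction s with
    | zero => rfl
    | succ s ih => rw [Function.iterate_succ_apply', Function.iterate_succ_apply', ht, ih]
  rw [h1, map_sum, Finset.sum_apply, ← Finset.sum_range_reflect]
  refine Finset.sum_congr rfl fun k hk => ?_
  have hk' := Finset.mem_range.1 hk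
  rw [map_smul, Pi.smul_apply, h2, iterate_delay_apply, smul_eq_mul, if_pos (by omega), mul_comm]
  rw [show t - (t + 1 - 1 - k) = k by omega, show t + 1 - 1 - k = t - k by omega]

/-- The time-reversed sign sequence of the impulse response, an input bounded by `1`, produces the
partial sum as output at the last instant. -/
lemma sum_abs_impulse_le_gain {g : Sys ℝ ℝ} (hc : IsCausal g) (ht : IsTimeInvariant g)
    (hs : IsStable g) (N : ℕ) :
    ∑ k ∈ Finset.range N, |g impulse k| ≤ (gain g).toReal := by
  cases N with
  | zero => simp
  | succ T =>
    have h := norm_apply_le_of_gain g hs (T := T)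
      (x := fun t => (SignType.sign (g impulse (T - t)) : ℝ)) (r := 1)
      (fun s _ => by
        rw [Real.norm_eq_abs]
        rcases lt_trichotomy (g impulse (T - s)) 0 with h | h | h <;> simp [h]) (le_refl T)
    rw [mul_one, apply_eq_convolution hc ht] at h
    refine le_trans (le_of_eq ?_) ((le_abs_self _).trans h)
    refine Finset.sum_congr rfl fun k hk => ?_
    have hk' := Finset.mem_range.1 hk
    rw [show T - (T - k) = k by omega, self_mul_sign]

lemma exists_lt_sum_abs_impulse {g : Sys ℝ ℝ} (hc : IsCausal g) (ht : IsTimeInvariant g)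
    {a : ℝ} (ha0 : 0 ≤ a) (ha : a < (gain g).toReal) :
    ∃ L, a < ∑ k ∈ Finset.range L, |g impulse k| := by
  by_contra! hcon
  refine absurd ha (not_lt.2 (ENNReal.toReal_le_of_le_ofReal ha0 ?_))
  rw [gain_le_ofReal_iff _ ha0]
  intro T x r hr t htT
  have hr0 : 0 ≤ r := (norm_nonneg _).trans (hr 0 (Nat.zero_le _))
  rw [apply_eq_convolution hc ht, Real.norm_eq_abs]
  refine (Finset.abs_sum_le_sum_abs _ _).trans ?_
  refine le_trans ?_ (mul_le_mul_of_nonneg_right (hcon (t + 1)) hr0)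
  rw [Finset.sum_mul]
  refine Finset.sum_le_sum fun k _ => ?_
  rw [abs_mul]
  exact mul_le_mul_of_nonneg_left (hr _ (by omega)) (abs_nonneg _)

end Convolution

/-! ### A destabilizing time-varying perturbation in one channel. -/

section Destabilization

/-- The gain sequence of the destabilizing perturbation for the impulse response `h`. -/
def blockGain (h : ℕ → ℝ) (c : ℝ) (L t : ℕ) : ℝ :=
  -- For `0 < t` and `0 < L`, `(t - 1) / L = j` exactly when `jL < t ≤ (j + 1)L`. Time `0` is
  -- excluded because truncated subtraction would put it in block `0`.
  if t = 0 then 0 else c * (SignType.sign (h (L * ((t - 1) / L + 1) - t)) : ℝ)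

lemma abs_blockGain_le (h : ℕ → ℝ) {c : ℝ} (hc : 0 ≤ c) (L t : ℕ) : |blockGain h c L t| ≤ c := by
  unfold blockGain
  split_ifs
  · simpa
  · rcases lt_trichotomy (h (L * ((t - 1) / L + 1) - t)) 0 with h | h | h <;>
      simp [h, abs_of_nonneg hc, hc]

/-- The perturbation which acts on channel `k` only: in the block `(jL, (j + 1)L]` its output is a
multiple of the sampled value of its input at time `jL`. -/
def blockPerturbation {n : ℕ} (k : Fin n) (h : ℕ → ℝ) (c : ℝ) (L : ℕ) :
    Sys (Fin n → ℝ) (Fin n → ℝ) where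
  toFun x := fun t => Pi.single k (blockGain h c L t * x (L * ((t - 1) / L)) k)
  map_add' x y := by
    funext t
    simp [mul_add, Pi.single_add]
  map_smul' a x := by
    funext t
    simp only [Pi.smul_apply, smul_eq_mul, RingHom.id_apply]
    rw [← Pi.single_smul, smul_eq_mul]
    congr 1
    ring

variable {n : ℕ} (k : Fin n) (h : ℕ → ℝ) {c : ℝ} (L : ℕ)

lemma sample_le (L t : ℕ) : L * ((t - 1) / L) ≤ t :=
  (Nat.mul_div_le _ _).trans (Nat.sub_le _ _)

lemma gain_blockPerturbation_le (hc : 0 ≤ c) :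
    gain (blockPerturbation k h c L) ≤ ENNReal.ofReal c := by
  rw [gain_le_ofReal_iff _ hc]
  intro T x r hr t ht
  change ‖(Pi.single k (blockGain h c L t * x (L * ((t - 1) / L)) k) : Fin n → ℝ)‖ ≤ _
  rw [Pi.norm_single, norm_mul]
  exact mul_le_mul (abs_blockGain_le h hc L t)
    ((norm_le_pi_norm _ k).trans (hr _ ((sample_le L t).trans ht))) (norm_nonneg _) hc

lemma entry_blockPerturbation {i j : Fin n} (hij : i ≠ k ∨ j ≠ k) :
    entry (blockPerturbation k h c L) i j = 0 := by
  refine LinearMap.ext fun x => funext fun t => ?_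
  change (Pi.single k (blockGain h c L t * (Pi.single j (x (L * ((t - 1) / L))) : Fin n → ℝ) k) :
    Fin n → ℝ) i = 0
  rcases hij with hij | hij
  · simp [hij]
  · simp [Pi.single_eq_of_ne' hij]

lemma blockPerturbation_mem (hc : 0 ≤ c) :
    blockPerturbation k h c L ∈ diagonalUncertainty n := by
  refine ⟨isCausal_of_congr fun T x y hxy => ?_,
    (gain_blockPerturbation_le k h L hc).trans_lt ENNReal.ofReal_lt_top, fun i j hij => ?_⟩
  · change (Pi.single k _ : Fin n → ℝ) = Pi.single k _
    rw [hxy _ (sample_le L T)]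
  · refine entry_blockPerturbation k h L ?_
    by_contra! hcon
    exact hij (hcon.1.trans hcon.2.symm)

lemma gain_zero : gain (0 : Sys ℝ ℝ) = 0 := by
  have := (gain_le_ofReal_iff (0 : Sys ℝ ℝ) le_rfl).2 (fun T x r _ t _ => by simp)
  simpa using this

lemma sum_gain_blockPerturbation_le (hc : 0 ≤ c) :
    ∑ i, gain (entry (blockPerturbation k h c L) i i) ≤ ENNReal.ofReal c := by
  rw [Finset.sum_eq_single k]
  · exact (gain_entry_le _ (blockPerturbation_mem k h L hc).2.1 k k).trans
      (gain_blockPerturbation_le k h L hc)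
  · intro i _ hi
    rw [entry_blockPerturbation k h L (Or.inl hi), gain_zero]
  · simp

/-- Along the sampling instants the closed loop signal grows at least geometrically. -/
lemma geometric_growth {h y : ℕ → ℝ} {c q ε : ℝ} {L : ℕ} (hc : 0 ≤ c) (hq : 1 ≤ q) (hL : 0 < L)
    (hy0 : y 0 = 1)
    (hy : ∀ t, 0 < t → y t = ∑ k ∈ Finset.range (t + 1),
      h k * (blockGain h c L (t - k) * y (L * ((t - k - 1) / L))))
    (htail : ∀ N, ∑ k ∈ Finset.Ico L N, |h k| ≤ ε)
    (hqS : q ≤ c * (∑ k ∈ Finset.range L, |h k|) - c * ε) (j : ℕ) :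
    q ^ j ≤ |y (L * j)| ∧ ∀ i ≤ j, |y (L * i)| ≤ |y (L * j)| := by
  induction j with
  | zero => simp [hy0]
  | succ j ih =>
    obtain ⟨ih1, ih2⟩ := ih
    have hstep : q * |y (L * j)| ≤ |y (L * (j + 1))| := by
      rw [hy (L * (j + 1)) (by positivity), ← Finset.sum_range_add_sum_Ico _
        (show L ≤ L * (j + 1) + 1 by nlinarith)]
      -- The latest `L` terms all use the sample `y (L * j)`, and their signs match those of `h`.
      have hhead : ∑ k ∈ Finset.range L, h k * (blockGain h c L (L * (j + 1) - k) *
          y (L * ((L * (j + 1) - k - 1) / L)))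
          = c * (∑ k ∈ Finset.range L, |h k|) * y (L * j) := by
        rw [Finset.mul_sum, Finset.sum_mul]
        refine Finset.sum_congr rfl fun k hk => ?_
        have hk' := Finset.mem_range.1 hk
        have hLj : L * (j + 1) = L * j + L := by ring
        have hdiv : (L * (j + 1) - k - 1) / L = j := by
          rw [hLj, show L * j + L - k - 1 = (L - k - 1) + L * j by omega,
            Nat.add_mul_div_left _ _ hL, Nat.div_eq_of_lt (by omega), zero_add]
        unfold blockGain
        rw [if_neg (by omega), hdiv, show L * (j + 1) - (L * (j + 1) - k) = k by omega,
          ← self_mul_sign (h k)]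
        ring
      have htl : |∑ k ∈ Finset.Ico L (L * (j + 1) + 1), h k * (blockGain h c L (L * (j + 1) - k) *
          y (L * ((L * (j + 1) - k - 1) / L)))| ≤ ε * (c * |y (L * j)|) := by
        refine (Finset.abs_sum_le_sum_abs _ _).trans ?_
        refine le_trans ?_ (mul_le_mul_of_nonneg_right (htail (L * (j + 1) + 1)) (by positivity))
        rw [Finset.sum_mul]
        refine Finset.sum_le_sum fun k hk => ?_
        have hk' := Finset.mem_Ico.1 hk
        rw [abs_mul, abs_mul]
        refine mul_le_mul_of_nonneg_left ?_ (abs_nonneg _)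
        -- Older blocks use earlier samples; the running-maximum half of the induction bounds them
        -- by `|y (L * j)|`.
        refine mul_le_mul (abs_blockGain_le h hc L _) (ih2 _ ?_) (abs_nonneg _) hc
        have hLj : L * (j + 1) = L * j + L := by ring
        exact Nat.div_le_of_le_mul (by omega)
      rw [hhead]
      have hpos : 0 ≤ c * ∑ k ∈ Finset.range L, |h k| := by positivity
      have habs : |c * (∑ k ∈ Finset.range L, |h k|) * y (L * j)|
          = c * (∑ k ∈ Finset.range L, |h k|) * |y (L * j)| := by
        rw [abs_mul, abs_of_nonneg hpos]
      have h1 := abs_sub_abs_le_abs_add (c * (∑ k ∈ Finset.range L, |h k|) * y (L * j))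
        (∑ k ∈ Finset.Ico L (L * (j + 1) + 1), h k * (blockGain h c L (L * (j + 1) - k) *
          y (L * ((L * (j + 1) - k - 1) / L))))
      have h2 := mul_le_mul_of_nonneg_right hqS (abs_nonneg (y (L * j)))
      rw [habs] at h1
      nlinarith
    have hmono : |y (L * j)| ≤ |y (L * (j + 1))| :=
      (le_mul_of_one_le_left (abs_nonneg _) hq).trans hstep
    refine ⟨?_, fun i hi => ?_⟩
    · rw [pow_succ, mul_comm]
      exact (mul_le_mul_of_nonneg_left ih1 (by linarith)).trans hstep
    · rcases Nat.le_succ_iff.1 hi with hi | rfl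
      · exact (ih2 i hi).trans hmono
      · exact le_rfl

/-- Perturbations of gain larger than `1 / ‖G_kk‖_1` in channel `k` can destabilize the loop. -/
theorem exists_destabilizing {G : Sys (Fin n → ℝ) (Fin n → ℝ)}
    (hcausal : IsCausal G) (hstable : IsStable G) (hinv : IsTimeInvariant G) (hc : 0 < c)
    (hk : 1 / c < (gain (entry G k k)).toReal) :
    ∃ Δ ∈ diagonalUncertainty n, ¬ HasStableInverse (LinearMap.id - G ∘ₗ Δ) ∧
      ∑ i, gain (entry Δ i i) ≤ ENNReal.ofReal c := by
  set g := entry G k k with hg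
  set m := (gain g).toReal with hm
  have gc := isCausal_entry G hcausal k k
  have gs := isStable_entry G hstable k k
  have gt := isTimeInvariant_entry G hinv k k
  have hc' : 0 < 1 / c := by positivity
  -- The head sum exceeds `m - ε` and the tail is at most `ε`, giving growth factor `c (m - 2ε) =
  -- (cm + 1) / 2 > 1`.
  set ε := (m - 1 / c) / 4 with hε
  have hεpos : 0 < ε := by rw [hε]; linarith
  obtain ⟨L, hLS⟩ := exists_lt_sum_abs_impulse gc gt (a := m - ε) (by rw [hε]; linarith)
    (by linarith)
  have hL : 0 < L := by
    rcases Nat.eq_zero_or_pos L with rfl | hL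
    · simp at hLS
      linarith
    · exact hL
  have htail : ∀ N, ∑ i ∈ Finset.Ico L N, |g impulse i| ≤ ε := by
    intro N
    rcases le_total L N with hN | hN
    · have h1 := sum_abs_impulse_le_gain gc gt gs N
      rw [← Finset.sum_range_add_sum_Ico _ hN] at h1
      linarith
    · rw [Finset.Ico_eq_empty_of_le hN]
      simpa using hεpos.le
  set q := c * (m - 2 * ε) with hq
  have hq1 : 1 < q := by
    have h1 : 1 = c * (1 / c) := by field_simp
    rw [hq]
    conv_lhs => rw [h1]
    exact mul_lt_mul_of_pos_left (by linarith) hc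
  refine ⟨blockPerturbation k (g impulse) c L, blockPerturbation_mem k _ L hc.le, ?_,
    sum_gain_blockPerturbation_le k _ L hc.le⟩
  rintro ⟨K, -, hK, hKs⟩
  -- An impulse in channel `k` is a bounded input whose response under a stable inverse would have
  -- to stay bounded.
  set u : ℕ → Fin n → ℝ := fun t => Pi.single k (impulse t) with hu
  have hloop : ∀ t, K u t k = impulse t + ∑ i ∈ Finset.range (t + 1), g impulse i *
      (blockGain (g impulse) c L (t - i) * K u (L * ((t - i - 1) / L)) k) := by
    intro t
    have h1 := congrFun (congrFun (LinearMap.congr_fun hK u) t) k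
    have h2 : G (blockPerturbation k (g impulse) c L (K u)) t k
        = g (fun s => blockGain (g impulse) c L s * K u (L * ((s - 1) / L)) k) t := rfl
    rw [apply_eq_convolution gc gt] at h2
    have h3 : u t k = impulse t := by simp [hu]
    change K u t k - G (blockPerturbation k (g impulse) c L (K u)) t k = u t k at h1
    rw [h2, h3] at h1
    linarith
  have hgrow := geometric_growth (h := g impulse) (y := fun t => K u t k) (q := q) (ε := ε)
    hc.le hq1.le hL
    (by
      have := hloop 0
      simpa [impulse, blockGain] using this)
    (fun t ht => by simpa [impulse, ht.ne'] using hloop t) htail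
    (by
      have := mul_lt_mul_of_pos_left hLS hc
      rw [hq]
      nlinarith)
  obtain ⟨j, hj⟩ := pow_unbounded_of_one_lt (gain K).toReal hq1
  have hbd := norm_apply_le_of_gain K hKs (T := L * j) (x := u) (r := 1)
    (fun s _ => by
      rw [hu, Pi.norm_single]
      unfold impulse
      split_ifs <;> simp) le_rfl
  have h1 := (norm_le_pi_norm (K u (L * j)) k).trans hbd
  have h2 := (hgrow j).1
  rw [Real.norm_eq_abs] at h1
  linarith

end Destabilization

/-! ### The `1`-to-`∞` matrix norm and diagonal scaling. -/

section Norms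

variable {n : ℕ}

lemma oneInfNorm_le {A : Matrix (Fin n) (Fin n) ℝ} {m : ℝ} (hm : 0 ≤ m)
    (hA : ∀ i j, |A i j| ≤ m) : oneInfNorm A ≤ ENNReal.ofReal m := by
  refine iSup_le fun x => ?_
  have hne : ∑ i, ‖x i‖ₑ ≠ ∞ := ENNReal.sum_ne_top.2 fun _ _ => enorm_ne_top
  rw [ENNReal.div_le_iff_le_mul (Or.inr ENNReal.ofReal_ne_top) (Or.inl hne)]
  have h1 : ‖A.mulVec x‖ ≤ m * ∑ i, ‖x i‖ := by
    refine (pi_norm_le_iff_of_nonneg (by positivity)).2 fun i => ?_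
    rw [Finset.mul_sum]
    refine (norm_sum_le Finset.univ fun j => A i j * x j).trans (Finset.sum_le_sum fun j _ => ?_)
    rw [norm_mul]
    exact mul_le_mul_of_nonneg_right (hA i j) (norm_nonneg _)
  rw [← ofReal_norm (A.mulVec x)]
  refine (ENNReal.ofReal_le_ofReal h1).trans (le_of_eq ?_)
  rw [ENNReal.ofReal_mul hm, ENNReal.ofReal_sum_of_nonneg fun _ _ => norm_nonneg _]
  simp only [ofReal_norm]

lemma le_oneInfNorm (A : Matrix (Fin n) (Fin n) ℝ) (i j : Fin n) :
    ENNReal.ofReal |A i j| ≤ oneInfNorm A := by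
  refine le_iSup_of_le (Pi.single j 1) ?_
  have h1 : ∑ l, ‖(Pi.single j 1 : Fin n → ℝ) l‖ₑ = 1 := by
    rw [Finset.sum_eq_single j]
    · simp
    · intro b _ hb
      simp [hb]
    · simp
  rw [h1, div_one, Matrix.mulVec_single_one, ← ofReal_norm (A.col j)]
  exact ENNReal.ofReal_le_ofReal (norm_le_pi_norm (A.col j) i)

lemma diagonal_conj_apply {d : Fin n → ℝ} (hd : ∀ i, 0 < d i) (M : Matrix (Fin n) (Fin n) ℝ)
    (i j : Fin n) :
    (Matrix.diagonal d * M * (Matrix.diagonal d)⁻¹) i j = d i * M i j / d j := by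
  have hinv : (Matrix.diagonal d)⁻¹ = Matrix.diagonal fun i => (d i)⁻¹ := by
    refine Matrix.inv_eq_right_inv ?_
    rw [Matrix.diagonal_mul_diagonal, ← Matrix.diagonal_one]
    congr 1
    funext i
    exact mul_inv_cancel₀ (hd i).ne'
  rw [hinv, Matrix.mul_diagonal, Matrix.diagonal_mul, div_eq_mul_inv]

end Norms

end RobustNu
end

/-! ### Equality of the two measures. -/

open RobustNu in
theorem mainTheorem5 (n : ℕ) (G : RobustNu.Sys (Fin n → ℝ) (Fin n → ℝ))
    (hcausal : RobustNu.IsCausal G) (hstable : RobustNu.IsStable G)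
    (hinv : RobustNu.IsTimeInvariant G)
    (hdiag : ∃ D ∈ RobustNu.positiveDiagonal n,
      RobustNu.IsDiagonallyMaximal (D * RobustNu.magnitudeMatrix G * D⁻¹)) :
    RobustNu.nuBar G = RobustNu.nu G := by
  obtain ⟨_, ⟨d, hd, rfl⟩, k, hk⟩ := hdiag
  set m := (gain (entry G k k)).toReal with hm
  have hm0 : 0 ≤ m := ENNReal.toReal_nonneg
  have hconj : ∀ {d : Fin n → ℝ}, (∀ i, 0 < d i) →
      |(Matrix.diagonal d * magnitudeMatrix G * (Matrix.diagonal d)⁻¹) k k| = m := by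
    intro d hd
    rw [diagonal_conj_apply hd, mul_div_right_comm, div_self (hd k).ne', one_mul]
    exact abs_of_nonneg hm0
  rw [hconj hd] at hk
  have hD : Matrix.diagonal d ∈ positiveDiagonal n := ⟨d, hd, rfl⟩
  have hnuBar : nuBar G = ENNReal.ofReal m := by
    refine le_antisymm (iInf₂_le_of_le (Matrix.diagonal d) hD (oneInfNorm_le hm0 hk)) ?_
    refine le_iInf₂ fun D hD => ?_
    obtain ⟨d', hd', rfl⟩ := hD
    have h := le_oneInfNorm (Matrix.diagonal d' * magnitudeMatrix G * (Matrix.diagonal d')⁻¹) k k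
    rwa [hconj hd'] at h
  rw [hnuBar, nu, one_div]
  refine le_antisymm ?_ ?_
  · rw [← inv_inv (ENNReal.ofReal m), ENNReal.inv_le_inv]
    -- The infimum need not be attained, so each level `a` above `1 / m` is treated; if `m = 0`
    -- there is none.
    refine le_of_forall_gt_imp_ge_of_dense fun a ha => ?_
    rcases eq_or_ne a ∞ with rfl | hatop
    · exact le_top
    have ha0 : 0 < a := lt_of_le_of_lt zero_le ha
    have hareal : 0 < a.toReal := ENNReal.toReal_pos ha0.ne' hatop
    have hlt : 1 / a.toReal < m := by
      rw [← ENNReal.ofReal_toReal hatop] at ha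
      have h1 := ENNReal.inv_lt_iff_inv_lt.1 ha
      rw [← ENNReal.ofReal_inv_of_pos hareal] at h1
      rw [one_div]
      exact lt_of_not_ge fun h => absurd (ENNReal.ofReal_le_ofReal h) (not_le.2 h1)
    obtain ⟨Δ, hΔ, hns, hle⟩ := exists_destabilizing k hcausal hstable hinv hareal hlt
    rw [ENNReal.ofReal_toReal hatop] at hle
    exact sInf_le_of_le (Exists.intro Δ ⟨hΔ, hns, rfl⟩) hle
  · rw [ENNReal.inv_le_iff_inv_le]
    refine le_sInf ?_
    rintro r ⟨Δ, hΔ, hns, rfl⟩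
    by_contra! hlt
    refine hns ((weightedBound_comp hstable hΔ hd (m := m) fun i j => ?_).hasStableInverse
      (isCausal_comp hcausal hΔ.1) hd ?_)
    · have := hk i j
      rw [diagonal_conj_apply hd] at this
      exact (le_abs_self _).trans this
    · have hfin : ∀ i ∈ Finset.univ, gain (entry Δ i i) ≠ ∞ := fun i _ =>
        ne_of_lt (isStable_entry Δ hΔ.2.1 i i)
      have hsum : ∑ i, (gain (entry Δ i i)).toReal = (∑ i, gain (entry Δ i i)).toReal :=
        (ENNReal.toReal_sum hfin).symm
      rw [hsum]
      -- For `m = 0` the inverse is `∞` and gives no real bound on the sum, but the loop bound is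
      -- already `0`.
      rcases hm0.eq_or_lt with h0 | hpos
      · rw [← h0]
        simp
      · rw [← ENNReal.ofReal_inv_of_pos hpos] at hlt
        have h1 := (ENNReal.lt_ofReal_iff_toReal_lt (ENNReal.sum_ne_top.2 hfin)).1 hlt
        calc _ < m * m⁻¹ := mul_lt_mul_of_pos_left h1 hpos
          _ = 1 := mul_inv_cancel₀ hpos.ne'
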